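/- **Model.** Let $d\ge 2$, $2\le J\le d$. Let $X=(X_1,\dots,X_d)$ take values in $\mathcal X\subseteq\mathbb R^d$, $U$ in $\mathcal U\subseteq\mathbb R$, $V$ in $\mathcal V\subseteq\mathbb R^{d_V}$, and put $W=(X_{J+1},\dots,X_d)$. The latent outcome is $H=h(X,U)$ with $h:\mathcal X\times\mathcal U\to\mathcal H\subseteq\mathbb R$, and the report is $R=r(H,V)$ with $r:\mathcal H\times\mathcal V\to\mathcal R$, where $\mathcal R\subset\mathbb R$ is a finite set of response categories (for example $\{0,1,\dots,\bar R\}$). All functions are measurable. Assume: * (HONEST) $r(\cdot,v)$ is weakly increasing and left-continuous on $\mathcal H$ for every $v\in\mathcal V$. * (EXOG) $(X_1,\dots,X_J)$ is independent of $V$ conditionally on $W$, and independent of $U$ conditionally on $(W,V)$. * (REG, for $j=1$ and for $j=2$) $X_j$ has a density; and for some version of the conditional laws given $(X,V)=(x,v)$ and all $x\in\mathcal X$, $v\in\mathcal V$: $H$ has a density; the conditional quantile function $Q_{H|XV}(\alpha|x,v)$, $0<\alpha<1$, is differentiable in $x_j$ with $\partial_{x_j}Q_{H|XV}(\alpha|x,v)\le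 C<\infty$, where $C$ does not depend on $(\alpha,x,v)$; and $(H,\partial_{x_j}h(x,U))$ has a density $f(y,y'|x,v)\le c(y')$ with respect to $dy\otimes\nu(dy')$, where $\int c(y')|y'|\,\nu(dy')<\infty$. Here $\nu$ is some $\sigma$-finite measure on $\mathbb R$ (for example Lebesgue measure, or a point mass when $\partial_{x_j}h$ is constant), and $c$ and $\nu$ do not depend on $(x,v)$. **Statement.** Suppose that $h(x,u)=\beta_1x_1+\beta_2x_2+g(x_3,\dots,x_d)+u$ on $\mathcal X\times\mathcal U$ with $\beta_2>0$. Then the conditional expectation function of $R$ is weakly separable: there are $\gamma_1,\gamma_2\in\mathbb R$ with $\gamma_2\ne0$ and a measurable function $\phi$ such that $$\mathbb E[R\mid X=x]=\phi(\gamma_1x_1+\gamma_2x_2,\;x_3,\dots,x_d)\quad\text{for almost all }x\text{ under the law }P_X\text{ of }X,\qquad \frac{\gamma_1}{\gamma_2}=\frac{\beta_1}{\beta_2}.$$ Moreover the ratio is the same in every such representation unless the function is degenerate: let $\gamma_1,\gamma_2,\phi$ be any reals and measurable function for which the displayed identity for $\mathbb E[R\mid X=x]$ holds, let $I_1,I_2$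 be bounded open intervals and $B\subseteq\mathbb R^{d-2}$ a Borel set such that $\rho=\lambda|_{I_1}\otimes\lambda|_{I_2}\otimes P_{(X_3,\dots,X_d)}|_B$ ($\lambda$ Lebesgue measure) is absolutely continuous with respect to $P_X$; if $\phi(\gamma_1x_1+\gamma_2x_2,x_3,\dots,x_d)$ is not $\rho$-almost everywhere equal to a measurable function of $(x_3,\dots,x_d)$ alone, then $\gamma_2\neq0$ and $\gamma_1/\gamma_2=\beta_1/\beta_2$. -/

import Mathlib

open MeasureTheory ProbabilityTheory Set
open scoped NNReal ENNReal

/-- The `α`-quantile `inf {y : α ≤ F(y)}` of a law on the line with distribution function `F`.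
It is used only for probability measures and `0 < α < 1`, where the infimum is a minimum. -/
noncomputable def quantile (μ : Measure ℝ) (α : ℝ) : ℝ :=
  sInf {y : ℝ | α ≤ cdf μ y}

/-- The values of `t` that can replace the `j`-th coordinate of `x` without leaving `S`. -/
def slice {d : ℕ} (S : Set (Fin d → ℝ)) (x : Fin d → ℝ) (j : Fin d) : Set ℝ :=
  {t : ℝ | Function.update x j t ∈ S}

/-- `(x₃, …, x_d)` for a vector `x = (x₁, …, x_d)`, `d = n + 2`. -/
def tailTwo {n : ℕ} (x : Fin (n + 2) → ℝ) : Fin n → ℝ := fun i => x i.succ.succ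

/-- The reporting model: covariates `X`, heterogeneity `U` of the structural function and `V` of
the reporting function, a latent outcome `H = h(X, U)` and a report `R = r(H, V)` that takes
finitely many real values. The functions `h` and `r` matter only on `𝒳 × 𝒰` and `𝓗 × 𝒱`. -/
structure ReportModel {Ω : Type*} [MeasurableSpace Ω] (P : Measure Ω) (d dV : ℕ)
    (𝓤 : Type*) [MeasurableSpace 𝓤] where
  /-- possible covariate values -/
  𝒳 : Set (Fin d → ℝ)
  /-- possible values of `U` -/
  𝒰 : Set 𝓤
  /-- possible values of `V` -/
  𝒱 : Set (Fin dV → ℝ)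
  /-- possible values of the latent outcome -/
  𝓗 : Set ℝ
  /-- response categories -/
  ℛ : Finset ℝ
  /-- structural function -/
  h : (Fin d → ℝ) → 𝓤 → ℝ
  /-- reporting function -/
  r : ℝ → (Fin dV → ℝ) → ℝ
  X : Ω → Fin d → ℝ
  U : Ω → 𝓤
  V : Ω → Fin dV → ℝ
  measurable_h : Measurable (Function.uncurry h)
  measurable_r : Measurable (Function.uncurry r)
  measurable_X : Measurable X
  measurable_U : Measurable U
  measurable_V : Measurable V
  X_mem : ∀ᵐ ω ∂P, X ω ∈ 𝒳
  U_mem : ∀ᵐ ω ∂P, U ω ∈ 𝒰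
  V_mem : ∀ᵐ ω ∂P, V ω ∈ 𝒱
  h_mem : ∀ x ∈ 𝒳, ∀ u ∈ 𝒰, h x u ∈ 𝓗
  r_mem : ∀ y ∈ 𝓗, ∀ v ∈ 𝒱, r y v ∈ ℛ

namespace ReportModel

variable {Ω : Type*} [MeasurableSpace Ω] {P : Measure Ω} {d dV : ℕ}
  {𝓤 : Type*} [MeasurableSpace 𝓤]

/-- The latent outcome. -/
def H (M : ReportModel P d dV 𝓤) (ω : Ω) : ℝ := M.h (M.X ω) (M.U ω)

/-- The report. -/
def R (M : ReportModel P d dV 𝓤) (ω : Ω) : ℝ := M.r (M.H ω) (M.V ω)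

/-- The treatments `(X₁, …, X_J)`. -/
def treat (M : ReportModel P d dV 𝓤) (J : ℕ) (ω : Ω) : {i : Fin d // (i : ℕ) < J} → ℝ :=
  fun i => M.X ω i

/-- The controls `W = (X_{J+1}, …, X_d)`. -/
def ctrl (M : ReportModel P d dV 𝓤) (J : ℕ) (ω : Ω) : {i : Fin d // J ≤ (i : ℕ)} → ℝ :=
  fun i => M.X ω i

theorem measurable_ctrl (M : ReportModel P d dV 𝓤) (J : ℕ) : Measurable (M.ctrl J) :=
  measurable_pi_lambda _ fun i => (measurable_pi_apply i.1).comp M.measurable_X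

/-- HONEST: reporting functions are weakly increasing and left-continuous in the latent outcome. -/
def Honest (M : ReportModel P d dV 𝓤) : Prop :=
  ∀ v ∈ M.𝒱, MonotoneOn (fun y => M.r y v) M.𝓗 ∧
    ∀ y ∈ M.𝓗, ContinuousWithinAt (fun y' => M.r y' v) (M.𝓗 ∩ Iic y) y

/-- EXOG: `(X₁, …, X_J) ⫫ V | W` and `(X₁, …, X_J) ⫫ U | (W, V)`. -/
def Exog [StandardBorelSpace Ω] [IsFiniteMeasure P] (M : ReportModel P d dV 𝓤) (J : ℕ) : Prop :=
  CondIndepFun (MeasurableSpace.comap (M.ctrl J) inferInstance)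
      (M.measurable_ctrl J).comap_le (M.treat J) M.V P ∧
    CondIndepFun (MeasurableSpace.comap (fun ω => (M.ctrl J ω, M.V ω)) inferInstance)
      ((M.measurable_ctrl J).prodMk M.measurable_V).comap_le (M.treat J) M.U P

/-- `κ` is a version of the conditional law of `U` given `(X, V)`; the conditional law of `H`
given `X = x`, `V = v` is then the image of `κ (x, v)` under `h x`. -/
def IsVersion (M : ReportModel P d dV 𝓤)
    (κ : Kernel ((Fin d → ℝ) × (Fin dV → ℝ)) 𝓤) : Prop :=
  P.map (fun ω => ((M.X ω, M.V ω), M.U ω)) = (P.map fun ω => (M.X ω, M.V ω)).compProd κ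

/-- The conditional quantile function `Q_{H|XV}(α | x, v)` computed from the version `κ`. -/
noncomputable def Q (M : ReportModel P d dV 𝓤)
    (κ : Kernel ((Fin d → ℝ) × (Fin dV → ℝ)) 𝓤) (α : ℝ) (x : Fin d → ℝ) (v : Fin dV → ℝ) : ℝ :=
  quantile ((κ (x, v)).map (M.h x)) α

/-- `h'` is the partial derivative of the structural function in the `j`-th covariate. -/
def IsPartial (M : ReportModel P d dV 𝓤) (j : Fin d) (h' : (Fin d → ℝ) → 𝓤 → ℝ) : Prop :=
  (∀ x, Measurable (h' x)) ∧ ∀ x ∈ M.𝒳, ∀ u ∈ M.𝒰,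
    HasDerivWithinAt (fun t => M.h (Function.update x j t) u) (h' x u) (slice M.𝒳 x j) (x j)

/-- The conditional law of `(H, ∂ⱼh)` given `(X, V)` has a density `f(y, y' | x, v) ≤ c(y')` with
`∫ c(y') |y'| dν(y') < ∞`. The density is taken with respect to Lebesgue measure in `y` and a
reference measure `ν` in `y'`, which may be Lebesgue measure, but also, when `∂ⱼh` does not vary
with `u`, a point mass. -/
def HasBoundedJointDensity (M : ReportModel P d dV 𝓤) (j : Fin d)
    (κ : Kernel ((Fin d → ℝ) × (Fin dV → ℝ)) 𝓤) : Prop :=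
  ∃ h' : (Fin d → ℝ) → 𝓤 → ℝ, M.IsPartial j h' ∧
  ∃ ν : Measure ℝ, SigmaFinite ν ∧
  ∃ c : ℝ → ℝ≥0, Measurable c ∧ ∫⁻ y', (c y' : ℝ≥0∞) * ‖y'‖ₑ ∂ν < ∞ ∧
    ∀ x ∈ M.𝒳, ∀ v ∈ M.𝒱, ∃ f : ℝ × ℝ → ℝ≥0, Measurable f ∧
      (κ (x, v)).map (fun u => (M.h x u, h' x u))
        = ((volume : Measure ℝ).prod ν).withDensity (fun p => (f p : ℝ≥0∞)) ∧
      ∀ y y', f (y, y') ≤ c y'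

/-- REG for the `j`-th covariate: `X_j` is continuously distributed, and for a suitable version of
the conditional laws given `(X, V)`, `H` is continuously distributed, the conditional quantile
function has a partial derivative in `x_j` that is bounded above, and `(H, ∂ⱼh)` has a suitably
bounded density. -/
def Reg (M : ReportModel P d dV 𝓤) (j : Fin d) : Prop :=
  P.map (fun ω => M.X ω j) ≪ volume ∧
  ∃ κ : Kernel ((Fin d → ℝ) × (Fin dV → ℝ)) 𝓤, IsMarkovKernel κ ∧ M.IsVersion κ ∧
    (∀ x ∈ M.𝒳, ∀ v ∈ M.𝒱, (κ (x, v)).map (M.h x) ≪ volume) ∧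
    (∃ C : ℝ, ∀ α ∈ Ioo (0 : ℝ) 1, ∀ x ∈ M.𝒳, ∀ v ∈ M.𝒱, ∃ q : ℝ,
      HasDerivWithinAt (fun t => M.Q κ α (Function.update x j t) v) q (slice M.𝒳 x j) (x j) ∧
        q ≤ C) ∧
    M.HasBoundedJointDensity j κ

end ReportModel

/-- In the model `M` the conditional expectation of the report is
`E[R | X = x] = φ(γ₁ x₁ + γ₂ x₂, x₃, …, x_d)`, for almost all `x` under the law of `X`. -/
def ReportModel.IsSeparableCEF {Ω : Type*} [MeasurableSpace Ω] {P : Measure Ω} {n dV : ℕ}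
    {𝓤 : Type*} [MeasurableSpace 𝓤] (M : ReportModel P (n + 2) dV 𝓤) (γ₁ γ₂ : ℝ)
    (φ : ℝ × (Fin n → ℝ) → ℝ) : Prop :=
  Measurable φ ∧
    P[M.R | MeasurableSpace.comap M.X inferInstance] =ᵐ[P]
      fun ω => φ (γ₁ * M.X ω 0 + γ₂ * M.X ω 1, tailTwo (M.X ω))

/-! Existence: by contraction, the two exogeneity conditions make the law of `(V, U)` given `X` a
kernel `η` of the controls `W` (`Exog.exists_kernel`), and `J ≥ 2` places `W` inside `(x₃, …, x_d)`.
Integrating `r (β₁ x₁ + β₂ x₂ + g + u, v)` against `η` therefore gives a function of `β₁ x₁ + β₂ x₂`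
and `(x₃, …, x_d)`.

Uniqueness: two representations agree almost everywhere on the box. If their indices were linearly
independent, they would serve as coordinates on each slice with fixed `(x₃, …, x_d)`; a function of
one coordinate that equals a function of the other is locally constant, hence constant on the
connected slice (`exists_ae_eq_const_of_linearForms`). This is the excluded degenerate case, so the
indices are proportional. -/

/-! ### Conditional independence and kernels. -/

/-- Pushing the first marginal of a composition-product forward along a measurable map. -/
theorem compProd_map_left {α β γ : Type*} [MeasurableSpace α] [MeasurableSpace β]
    [MeasurableSpace γ] (μ : Measure α) [IsFiniteMeasure μ] {e : α → β} (he : Measurable e)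
    (κ : Kernel β γ) [IsMarkovKernel κ] :
    (μ ⊗ₘ κ.comap e he).map (Prod.map e id) = μ.map e ⊗ₘ κ := by
  ext s hs
  rw [Measure.map_apply (by fun_prop) hs, Measure.compProd_apply (hs.preimage (by fun_prop)),
    Measure.compProd_apply hs, lintegral_map (Kernel.measurable_kernel_prodMk_left hs) he]
  rfl

/-- If `T ⫫ Y | W`, then the conditional law of `Y` given `(W, T)` depends on `W` only. It can be
expressed through any variable `X` carrying the information in `(W, T)`. -/
theorem map_prodMk_eq_compProd_of_condIndepFun {Ω A B E S : Type*} [MeasurableSpace Ω]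
    [StandardBorelSpace Ω] [MeasurableSpace A] [MeasurableSpace B] [MeasurableSpace E]
    [MeasurableSpace S] [StandardBorelSpace A] [Nonempty A] [StandardBorelSpace S] [Nonempty S]
    {P : Measure Ω} [IsProbabilityMeasure P] {T : Ω → A} {W : Ω → B} {Y : Ω → S} {X : Ω → E}
    (hT : Measurable T) (hW : Measurable W) (hY : Measurable Y)
    {w : E → B} (hw : Measurable w) {j : B × A → E} (hj : Measurable j)
    (hXj : ∀ ω, X ω = j (W ω, T ω)) (hwj : ∀ b a, w (j (b, a)) = b)
    (h : CondIndepFun (MeasurableSpace.comap W inferInstance) hW.comap_le T Y P) :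
    P.map (fun ω => (X ω, Y ω)) = P.map X ⊗ₘ (condDistrib Y W P).comap w hw := by
  have h1 := (condIndepFun_iff_condDistrib_prod_ae_eq_prodMkRight hY hT hW).1 h
  rw [condDistrib_ae_eq_iff_measure_eq_compProd _ hY.aemeasurable] at h1
  have hX : X = fun ω => j (W ω, T ω) := funext hXj
  -- Since `w ∘ j` is the first projection, pulling back along `j` gives the kernel that ignores
  -- `T`.
  have hc : (condDistrib Y W P).prodMkRight A = ((condDistrib Y W P).comap w hw).comap j hj := by
    ext p : 1
    obtain ⟨b, a⟩ := p
    simp [Kernel.comap_apply, hwj]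
  have h2 := compProd_map_left (P.map fun ω => (W ω, T ω)) hj ((condDistrib Y W P).comap w hw)
  rw [← hc, ← h1, Measure.map_map (by fun_prop) (by fun_prop),
    Measure.map_map hj (by fun_prop)] at h2
  rw [hX]
  exact h2

/-- Contraction: if `T ⫫ V | W` and `T ⫫ U | (W, V)`, then the conditional law of `(V, U)` given
`(W, T)` depends on `W` only. -/
theorem exists_kernel_of_condIndepFun {Ω A B E S S' : Type*} [MeasurableSpace Ω]
    [StandardBorelSpace Ω] [MeasurableSpace A] [MeasurableSpace B] [MeasurableSpace E]
    [MeasurableSpace S] [MeasurableSpace S'] [StandardBorelSpace A] [Nonempty A]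
    [StandardBorelSpace S] [Nonempty S] [StandardBorelSpace S'] [Nonempty S']
    {P : Measure Ω} [IsProbabilityMeasure P] {T : Ω → A} {W : Ω → B} {V : Ω → S} {U : Ω → S'}
    {X : Ω → E} (hT : Measurable T) (hW : Measurable W) (hV : Measurable V) (hU : Measurable U)
    {w : E → B} (hw : Measurable w) {j : B × A → E} (hj : Measurable j)
    (hXj : ∀ ω, X ω = j (W ω, T ω)) (hwj : ∀ b a, w (j (b, a)) = b)
    (h : CondIndepFun (MeasurableSpace.comap W inferInstance) hW.comap_le T V P)
    (h' : CondIndepFun (MeasurableSpace.comap (fun ω => (W ω, V ω)) inferInstance)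
      (hW.prodMk hV).comap_le T U P) :
    ∃ η : Kernel B (S × S'), IsMarkovKernel η ∧
      P.map (fun ω => (X ω, V ω, U ω)) = P.map X ⊗ₘ η.comap w hw := by
  have h1 := map_prodMk_eq_compProd_of_condIndepFun hT hW hV hw hj hXj hwj h
  have h2 := map_prodMk_eq_compProd_of_condIndepFun (X := fun ω => (X ω, V ω)) hT (hW.prodMk hV) hU
    (w := fun p => (w p.1, p.2)) (by fun_prop) (j := fun p => (j (p.1.1, p.2), p.1.2))
    (by fun_prop) (fun ω => by rw [hXj]) (fun b a => by rw [hwj]) h'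
  have hX : Measurable X := by
    rw [show X = fun ω => j (W ω, T ω) from funext hXj]; fun_prop
  -- Draw `V` given `W`, then `U` given `(W, V)`.
  refine ⟨condDistrib V W P ⊗ₖ condDistrib U (fun ω => (W ω, V ω)) P, inferInstance, ?_⟩
  have hη : (condDistrib V W P ⊗ₖ condDistrib U (fun ω => (W ω, V ω)) P).comap w hw =
      (condDistrib V W P).comap w hw ⊗ₖ (condDistrib U (fun ω => (W ω, V ω)) P).comap
        (fun p : E × S => (w p.1, p.2)) (by fun_prop) := by
    ext x s hs
    rw [Kernel.comap_apply, Kernel.compProd_apply hs, Kernel.compProd_apply hs]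
    rfl
  rw [hη, ← Measure.compProd_assoc', ← h1, ← h2,
    Measure.map_map MeasurableEquiv.prodAssoc.measurable (by fun_prop)]
  rfl

/-! ### Functions of two linearly independent forms in the plane. -/

/-- `f` is almost everywhere equal to `c` near `x`. -/
def AEConstNear (f : ℝ × ℝ → ℝ) (x : ℝ × ℝ) (c : ℝ) : Prop :=
  ∃ u : Set (ℝ × ℝ), IsOpen u ∧ x ∈ u ∧ ∀ᵐ y, y ∈ u → f y = c

theorem AEConstNear.unique {f : ℝ × ℝ → ℝ} {x : ℝ × ℝ} {c c' : ℝ} (h : AEConstNear f x c)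
    (h' : AEConstNear f x c') : c = c' := by
  obtain ⟨u, hu, hxu, hf⟩ := h
  obtain ⟨u', hu', hxu', hf'⟩ := h'
  by_contra hne
  have hz : ∀ᵐ y : ℝ × ℝ, y ∉ u ∩ u' := by
    filter_upwards [hf, hf'] with y h1 h2 hy
    exact hne ((h1 hy.1).symm.trans (h2 hy.2))
  have h0 : volume (u ∩ u') = 0 := by
    rw [← compl_mem_ae_iff]; exact hz
  exact (((hu.inter hu').measure_pos volume ⟨x, hxu, hxu'⟩).ne') h0

/-- A function that is locally almost everywhere constant on a preconnected open set is almost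
everywhere constant there. -/
theorem exists_ae_eq_const_of_aeConstNear {f : ℝ × ℝ → ℝ} {O : Set (ℝ × ℝ)}
    (hO : IsPreconnected O) (h : ∀ x ∈ O, ∃ c, AEConstNear f x c) :
    ∃ c, ∀ᵐ x, x ∈ O → f x = c := by
  rcases O.eq_empty_or_nonempty with rfl | ⟨x₀, hx₀⟩
  · exact ⟨0, by simp⟩
  obtain ⟨c, hc⟩ := h x₀ hx₀
  have key : ∀ x ∈ O, AEConstNear f x c := by
    intro x hx
    -- Sharing a local constant is a symmetric relation that holds between nearby points; uniqueness
    -- of the constant makes it transitive.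
    have := hO.induction₂ (fun x y => ∃ c, AEConstNear f x c ∧ AEConstNear f y c)
      (fun x hx => by
        obtain ⟨c, u, hu, hxu, hf⟩ := h x hx
        filter_upwards [mem_nhdsWithin_of_mem_nhds (hu.mem_nhds hxu)] with y hy
        exact ⟨c, ⟨u, hu, hxu, hf⟩, ⟨u, hu, hy, hf⟩⟩)
      (fun x y z _ _ _ ⟨c, h1, h2⟩ ⟨c', h3, h4⟩ => ⟨c, h1, h2.unique h3 ▸ h4⟩)
      (fun x y _ _ ⟨c, h1, h2⟩ => ⟨c, h2, h1⟩) hx₀ hx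
    obtain ⟨c', h1, h2⟩ := this
    exact hc.unique h1 ▸ h2
  refine ⟨c, ?_⟩
  have h0 : volume {x | x ∈ O ∧ f x ≠ c} = 0 := by
    refine measure_null_of_locally_null _ fun x hx => ?_
    obtain ⟨u, hu, hxu, hf⟩ := key x hx.1
    refine ⟨{y | y ∈ O ∧ f y ≠ c} ∩ u,
      Filter.inter_mem self_mem_nhdsWithin (mem_nhdsWithin_of_mem_nhds (hu.mem_nhds hxu)), ?_⟩
    rw [← compl_mem_ae_iff]
    filter_upwards [hf] with y hy hy'
    exact hy'.1.2 (hy hy'.2)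
  rw [← compl_mem_ae_iff] at h0
  filter_upwards [h0] with x hx hxO
  by_contra hne
  exact hx ⟨hxO, hne⟩

/-- If a function of one coordinate agrees almost everywhere near `p` with a function of the other
coordinate, then it is almost everywhere constant near `p`. -/
theorem exists_ae_eq_const_of_ae_eq_fst_snd {a b : ℝ → ℝ} {I J : Set ℝ} (hJ : IsOpen J)
    (hJne : J.Nonempty) (h : ∀ᵐ p : ℝ × ℝ, p ∈ I ×ˢ J → a p.1 = b p.2) :
    ∃ c, ∀ᵐ s, s ∈ I → a s = c := by
  have h1 : ∀ᵐ p : ℝ × ℝ, p ∈ J ×ˢ I → a p.2 = b p.1 := by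
    have := (Measure.measurePreserving_swap (μ := (volume : Measure ℝ))
      (ν := (volume : Measure ℝ))).quasiMeasurePreserving.ae h
    filter_upwards [this] with p hp hpm
    exact hp ⟨hpm.2, hpm.1⟩
  have h2 := Measure.ae_ae_of_ae_prod h1
  -- By Fubini almost every `t` works, and `J` has positive measure.
  have h3 : ∃ t ∈ J, ∀ᵐ s : ℝ, (t, s) ∈ J ×ˢ I → a s = b t := by
    by_contra hcon
    refine (hJ.measure_pos volume hJne).ne' ?_
    rw [← compl_mem_ae_iff]
    filter_upwards [h2] with t ht htJ
    exact hcon ⟨t, htJ, ht⟩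
  obtain ⟨t, htJ, ht⟩ := h3
  exact ⟨b t, by filter_upwards [ht] with s hs hsI using hs ⟨htJ, hsI⟩⟩

/-- The inverse is Cramer's rule. -/
theorem exists_linearEquiv_linearForms {γ₁ γ₂ β₁ β₂ : ℝ} (hdet : γ₁ * β₂ - γ₂ * β₁ ≠ 0) :
    ∃ e : (ℝ × ℝ) ≃ₗ[ℝ] (ℝ × ℝ),
      ∀ x, e x = (γ₁ * x.1 + γ₂ * x.2, β₁ * x.1 + β₂ * x.2) := by
  refine ⟨{ toFun := fun x => (γ₁ * x.1 + γ₂ * x.2, β₁ * x.1 + β₂ * x.2)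
            invFun := fun y => ((β₂ * y.1 - γ₂ * y.2) / (γ₁ * β₂ - γ₂ * β₁),
              (γ₁ * y.2 - β₁ * y.1) / (γ₁ * β₂ - γ₂ * β₁))
            map_add' := fun x y => by ext <;> simp <;> ring
            map_smul' := fun c x => by ext <;> simp <;> ring
            left_inv := fun x => by
              ext
              · simp only [div_eq_iff hdet]; ring
              · simp only [div_eq_iff hdet]; ring
            right_inv := fun y => by
              ext
              · simp only [← mul_div_assoc, ← add_div, div_eq_iff hdet]; ring
              · simp only [← mul_div_assoc, ← add_div, div_eq_iff hdet]; ring }, fun x => rfl⟩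

/-- If a function of one linear form agrees almost everywhere on a connected open set with a function
of a linearly independent form, then it is almost everywhere constant there. -/
theorem exists_ae_eq_const_of_linearForms {γ₁ γ₂ β₁ β₂ : ℝ} (hdet : γ₁ * β₂ - γ₂ * β₁ ≠ 0)
    {a b : ℝ → ℝ} {O : Set (ℝ × ℝ)} (hO : IsOpen O) (hOc : IsPreconnected O)
    (h : ∀ᵐ x : ℝ × ℝ, x ∈ O → a (γ₁ * x.1 + γ₂ * x.2) = b (β₁ * x.1 + β₂ * x.2)) :
    ∃ c, ∀ᵐ x : ℝ × ℝ, x ∈ O → a (γ₁ * x.1 + γ₂ * x.2) = c := by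
  obtain ⟨e, he⟩ := exists_linearEquiv_linearForms hdet
  have hec : Continuous e := (e : (ℝ × ℝ) →ₗ[ℝ] (ℝ × ℝ)).continuous_of_finiteDimensional
  have hec' : Continuous e.symm :=
    (e.symm : (ℝ × ℝ) →ₗ[ℝ] (ℝ × ℝ)).continuous_of_finiteDimensional
  have hq : ∀ e : (ℝ × ℝ) ≃ₗ[ℝ] (ℝ × ℝ), Continuous e →
      Measure.QuasiMeasurePreserving e volume volume := fun e hec =>
    ⟨hec.measurable, Measure.AbsolutelyContinuous.mk fun s hs h0 => by
      rw [Measure.map_apply hec.measurable hs, Measure.addHaar_preimage_linearEquiv, h0, mul_zero]⟩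
  refine exists_ae_eq_const_of_aeConstNear hOc fun x hx => ?_
  have hnhds : e.symm ⁻¹' O ∈ nhds (e x) :=
    (hO.preimage hec').mem_nhds (by simpa using hx)
  obtain ⟨ε, hε, hball⟩ := Metric.mem_nhds_iff.1 hnhds
  -- In the coordinates `e`, a ball of the sup metric is a product of intervals, and the two forms
  -- are its coordinates.
  have h1 : ∀ᵐ p : ℝ × ℝ, p ∈ Metric.ball (e x).1 ε ×ˢ Metric.ball (e x).2 ε → a p.1 = b p.2 := by
    filter_upwards [(hq e.symm hec').ae h] with p hp hpm
    have hpO : e.symm p ∈ O := hball (by rw [← ball_prod_same] at *; exact hpm)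
    have := hp hpO
    have h2 := he (e.symm p)
    rw [e.apply_symm_apply] at h2
    rw [congrArg Prod.fst h2, congrArg Prod.snd h2]
    exact this
  obtain ⟨c, hc⟩ := exists_ae_eq_const_of_ae_eq_fst_snd Metric.isOpen_ball
    ⟨_, Metric.mem_ball_self hε⟩ h1
  refine ⟨c, (fun y => (e y).1) ⁻¹' Metric.ball (e x).1 ε,
    Metric.isOpen_ball.preimage (by fun_prop), Metric.mem_ball_self hε, ?_⟩
  have hf := (hq e hec).ae ((Measure.quasiMeasurePreserving_fst (μ := (volume : Measure ℝ))
    (ν := (volume : Measure ℝ))).ae hc)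
  filter_upwards [hf] with y hy hym
  have := hy hym
  rwa [he y] at this

/-! ### Separability of the conditional expectation in the model. -/

namespace ReportModel

variable {Ω : Type*} [MeasurableSpace Ω] {P : Measure Ω} {d dV : ℕ}
  {𝓤 : Type*} [MeasurableSpace 𝓤]

/-- Under exogeneity the conditional law of `(V, U)` given `X` depends on the controls only. -/
theorem Exog.exists_kernel [StandardBorelSpace Ω] [IsProbabilityMeasure P]
    [StandardBorelSpace 𝓤] [Nonempty 𝓤] {M : ReportModel P d dV 𝓤} {J : ℕ} (exog : M.Exog J) :
    ∃ η : Kernel ({i : Fin d // J ≤ (i : ℕ)} → ℝ) ((Fin dV → ℝ) × 𝓤), IsMarkovKernel η ∧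
      P.map (fun ω => (M.X ω, M.V ω, M.U ω)) =
        P.map M.X ⊗ₘ η.comap (fun x i => x i) (by fun_prop) := by
  have hT : Measurable (M.treat J) :=
    measurable_pi_lambda _ fun i => (measurable_pi_apply i.1).comp M.measurable_X
  refine exists_kernel_of_condIndepFun hT (M.measurable_ctrl J) M.measurable_V M.measurable_U
    (w := fun x i => x i) (by fun_prop)
    (j := fun p (i : Fin d) => if h : (i : ℕ) < J then p.2 ⟨i, h⟩ else p.1 ⟨i, not_lt.1 h⟩)
    ?_ (fun ω => ?_) (fun b a => ?_) exog.1 exog.2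
  · refine measurable_pi_lambda _ fun i => ?_
    by_cases h : (i : ℕ) < J
    · simp only [h, dite_true]; fun_prop
    · simp only [h, dite_false]; fun_prop
  · ext i
    by_cases h : (i : ℕ) < J <;> simp [h, treat, ctrl]
  · ext i
    simp [not_lt.2 i.2]

/-- Reports are almost surely response categories, so they are bounded. -/
theorem exists_ae_abs_R_le (M : ReportModel P d dV 𝓤) : ∃ C : ℝ, ∀ᵐ ω ∂P, |M.R ω| ≤ C := by
  obtain ⟨C, hC⟩ := (M.ℛ.image fun y => |y|).bddAbove
  refine ⟨C, ?_⟩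
  filter_upwards [M.X_mem, M.U_mem, M.V_mem] with ω hX hU hV
  exact hC (Finset.mem_coe.2 (Finset.mem_image_of_mem _
    (M.r_mem _ (M.h_mem _ hX _ hU) _ hV)))

theorem measurable_R (M : ReportModel P d dV 𝓤) : Measurable M.R :=
  M.measurable_r.comp
    ((M.measurable_h.comp (M.measurable_X.prodMk M.measurable_U)).prodMk M.measurable_V)

end ReportModel

/-- With a structural function that is additively separable in `U` and linear in `(x₁, x₂)`, the
conditional expectation function of the report is weakly separable with the same index. -/
theorem ReportModel.exists_isSeparableCEF {Ω : Type*} [MeasurableSpace Ω] [StandardBorelSpace Ω]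
    {P : Measure Ω} [IsProbabilityMeasure P] {n dV J : ℕ} (hJ : 2 ≤ J)
    {M : ReportModel P (n + 2) dV ℝ} (exog : M.Exog J) {β₁ β₂ : ℝ} {g : (Fin n → ℝ) → ℝ}
    (hg : Measurable g)
    (hh : ∀ x ∈ M.𝒳, ∀ u ∈ M.𝒰, M.h x u = x 0 * β₁ + x 1 * β₂ + g (tailTwo x) + u) :
    ∃ φ : ℝ × (Fin n → ℝ) → ℝ, M.IsSeparableCEF β₁ β₂ φ := by
  obtain ⟨η, hη, hmap⟩ := exog.exists_kernel
  obtain ⟨C, hC⟩ := M.exists_ae_abs_R_le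
  have hr := M.measurable_r
  have hX := M.measurable_X
  have hV := M.measurable_V
  have hU := M.measurable_U
  have htail : Measurable (tailTwo (n := n)) := by unfold tailTwo; fun_prop
  have hidx : ∀ i : {i : Fin (n + 2) // J ≤ (i : ℕ)}, (i : ℕ) - 2 < n := fun i => by
    have := i.1.2; have := i.2; omega
  -- Every control has index at least `J ≥ 2`, so it is read off the tail after a shift by 2.
  let c : (Fin n → ℝ) → {i : Fin (n + 2) // J ≤ (i : ℕ)} → ℝ := fun z i => z ⟨_, hidx i⟩
  have hcm : Measurable c := by fun_prop
  have hc : ∀ x : Fin (n + 2) → ℝ, c (tailTwo x) = fun i => x i.1 := fun x => by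
    ext i
    have := i.2
    simp only [c, tailTwo]
    congr 1
    ext
    simp only [Fin.val_succ]
    omega
  -- Truncating at `±C` changes nothing almost surely, because `|R| ≤ C`.
  let F : (ℝ × (Fin n → ℝ)) → (Fin dV → ℝ) × ℝ → ℝ := fun p y =>
    max (-C) (min C (M.r (p.1 + g p.2 + y.2) y.1))
  have hF : Measurable (Function.uncurry F) := by
    have : Measurable fun q : (ℝ × (Fin n → ℝ)) × (Fin dV → ℝ) × ℝ =>
        M.r (q.1.1 + g q.1.2 + q.2.2) q.2.1 :=
      hr.comp (f := fun q : (ℝ × (Fin n → ℝ)) × (Fin dV → ℝ) × ℝ =>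
        (q.1.1 + g q.1.2 + q.2.2, q.2.1)) (by fun_prop)
    exact measurable_const.max (measurable_const.min this)
  let s : (Fin (n + 2) → ℝ) → ℝ × (Fin n → ℝ) := fun x => (β₁ * x 0 + β₂ * x 1, tailTwo x)
  have hs : Measurable s := by fun_prop
  have hG : Measurable fun q : (Fin (n + 2) → ℝ) × (Fin dV → ℝ) × ℝ => F (s q.1) q.2 :=
    hF.comp (f := fun q : (Fin (n + 2) → ℝ) × (Fin dV → ℝ) × ℝ => (s q.1, q.2)) (by fun_prop)
  refine ⟨fun p => ∫ y, F p y ∂(η (c p.2)), ?_, ?_⟩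
  · exact (StronglyMeasurable.integral_kernel_prod_right
      (κ := η.comap (fun p : ℝ × (Fin n → ℝ) => c p.2) (by fun_prop))
      hF.stronglyMeasurable).measurable
  · have hR : M.R =ᵐ[P] fun ω => F (s (M.X ω)) (M.V ω, M.U ω) := by
      filter_upwards [M.X_mem, M.U_mem, hC] with ω hXω hUω hCω
      have h : M.R ω = M.r ((s (M.X ω)).1 + g (s (M.X ω)).2 + M.U ω) (M.V ω) := by
        simp only [ReportModel.R, ReportModel.H, hh _ hXω _ hUω, s]
        ring_nf
      rw [abs_le] at hCω
      simp only [F, ← h, min_eq_right hCω.2, max_eq_right hCω.1]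
    have hint : Integrable (fun ω => F (s (M.X ω)) (M.V ω, M.U ω)) P := by
      refine Integrable.congr ?_ hR
      exact Integrable.of_bound M.measurable_R.aestronglyMeasurable C hC
    have h1 := condExp_prod_ae_eq_integral_condDistrib hX (hV.prodMk hU).aemeasurable
      hG.stronglyMeasurable hint
    have h2 := ae_of_ae_map hX.aemeasurable
      (condDistrib_ae_eq_of_measure_eq_compProd M.X (hV.prodMk hU).aemeasurable hmap)
    refine (condExp_congr_ae hR).trans (h1.trans ?_)
    filter_upwards [h2] with ω hω
    rw [hω, Kernel.comap_apply, ← hc]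

/-! ### Uniqueness of the ratio. -/

/-- If functions of two linearly independent indices of `(x₁, x₂)` and of a third variable agree
almost everywhere on a box, then they depend on the third variable alone. -/
theorem exists_ae_eq_snd_of_linearForms {Z : Type*} [MeasurableSpace Z] {τ : Measure Z}
    [SFinite τ] {γ₁ γ₂ β₁ β₂ : ℝ} (hdet : γ₁ * β₂ - γ₂ * β₁ ≠ 0) {φ φ' : ℝ × Z → ℝ}
    (hφ : Measurable φ) (hφ' : Measurable φ') {a₁ b₁ a₂ b₂ : ℝ}
    (h : ∀ᵐ p ∂((volume.restrict (Ioo a₁ b₁)).prod (volume.restrict (Ioo a₂ b₂))).prod τ,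
      φ (γ₁ * p.1.1 + γ₂ * p.1.2, p.2) = φ' (β₁ * p.1.1 + β₂ * p.1.2, p.2)) :
    ∃ ψ : Z → ℝ, Measurable ψ ∧
      ∀ᵐ p ∂((volume.restrict (Ioo a₁ b₁)).prod (volume.restrict (Ioo a₂ b₂))).prod τ,
        φ (γ₁ * p.1.1 + γ₂ * p.1.2, p.2) = ψ p.2 := by
  rw [Measure.prod_restrict, ← Measure.volume_eq_prod] at *
  set O : Set (ℝ × ℝ) := Ioo a₁ b₁ ×ˢ Ioo a₂ b₂ with hOdef
  have hO : IsOpen O := isOpen_Ioo.prod isOpen_Ioo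
  have hOc : IsPreconnected O := isPreconnected_Ioo.prod isPreconnected_Ioo
  have hf : Measurable fun p : (ℝ × ℝ) × Z => φ (γ₁ * p.1.1 + γ₂ * p.1.2, p.2) :=
    hφ.comp (f := fun p : (ℝ × ℝ) × Z => (γ₁ * p.1.1 + γ₂ * p.1.2, p.2)) (by fun_prop)
  have hf' : Measurable fun p : (ℝ × ℝ) × Z => φ' (β₁ * p.1.1 + β₂ * p.1.2, p.2) :=
    hφ'.comp (f := fun p : (ℝ × ℝ) × Z => (β₁ * p.1.1 + β₂ * p.1.2, p.2)) (by fun_prop)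
  -- The slice average recovers the constant on each slice and, unlike a pointwise choice of
  -- constants, is visibly measurable in `z`.
  let ψ : Z → ℝ := fun z => ⨍ x in O, φ (γ₁ * x.1 + γ₂ * x.2, z)
  have hψ : Measurable ψ := by
    have := (hf.comp measurable_swap).stronglyMeasurable.integral_prod_right'
      (ν := (volume.restrict O))
    simp only [ψ, average_eq, smul_eq_mul]
    exact this.measurable.const_mul _
  refine ⟨ψ, hψ, ?_⟩
  have hz := Measure.ae_ae_of_ae_prod (Measure.measurePreserving_swap.quasiMeasurePreserving.ae h)
  have hz' : ∀ᵐ z ∂τ, ∀ᵐ x ∂(volume.restrict O), φ (γ₁ * x.1 + γ₂ * x.2, z) = ψ z := by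
    filter_upwards [hz] with z hz
    obtain ⟨c, hc⟩ := exists_ae_eq_const_of_linearForms hdet (a := fun s => φ (s, z))
      (b := fun s => φ' (s, z)) hO hOc ((ae_restrict_iff' hO.measurableSet).1 hz)
    rw [← ae_restrict_iff' hO.measurableSet] at hc
    rcases O.eq_empty_or_nonempty with h0 | hne
    · simp [h0]
    have hψz : ψ z = c := by
      have h1 : (volume O) ≠ 0 := (hO.measure_pos volume hne).ne'
      have h2 : (volume O) ≠ ∞ := by
        rw [hOdef, Measure.volume_eq_prod, Measure.prod_prod]
        exact ENNReal.mul_ne_top (by simp) (by simp)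
      have h3 : ψ z = ⨍ x in O, c := by
        simp only [ψ, average_eq]
        rw [integral_congr_ae hc]
      rw [h3, setAverage_const h1 h2]
    filter_upwards [hc] with x hx
    rw [hψz, hx]
  have hm : MeasurableSet {p : Z × (ℝ × ℝ) | φ (γ₁ * p.2.1 + γ₂ * p.2.2, p.1) = ψ p.1} :=
    measurableSet_eq_fun (hf.comp measurable_swap) (hψ.comp measurable_fst)
  exact Measure.measurePreserving_swap.quasiMeasurePreserving.ae
    ((Measure.ae_prod_iff_ae_ae hm).2 hz')

theorem corollary2 {Ω : Type*} [MeasurableSpace Ω] [StandardBorelSpace Ω]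
    (P : Measure Ω) [IsProbabilityMeasure P] (n dV J : ℕ) (hJ : 2 ≤ J) (hJd : J ≤ n + 2)
    (M : ReportModel P (n + 2) dV ℝ)
    (honest : M.Honest) (exog : M.Exog J) (reg₁ : M.Reg 0) (reg₂ : M.Reg 1)
    (β₁ β₂ : ℝ) (hβ₂ : 0 < β₂) (g : (Fin n → ℝ) → ℝ) (hg : Measurable g)
    (hh : ∀ x ∈ M.𝒳, ∀ u ∈ M.𝒰, M.h x u = x 0 * β₁ + x 1 * β₂ + g (tailTwo x) + u) :
    -- the conditional expectation function is weakly separable, with ratio `β₁ / β₂`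
    (∃ (γ₁ γ₂ : ℝ) (φ : ℝ × (Fin n → ℝ) → ℝ),
      M.IsSeparableCEF γ₁ γ₂ φ ∧ γ₂ ≠ 0 ∧ γ₁ / γ₂ = β₁ / β₂) ∧
    -- and this is the ratio in every such representation, if on some box that the law of `X`
    -- charges everywhere the function does not depend on `(x₃, …, x_d)` alone
    (∀ (γ₁ γ₂ : ℝ) (φ : ℝ × (Fin n → ℝ) → ℝ), M.IsSeparableCEF γ₁ γ₂ φ →
      ∀ (a₁ b₁ a₂ b₂ : ℝ) (B : Set (Fin n → ℝ)), MeasurableSet B →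
      ∀ ρ : Measure ((ℝ × ℝ) × (Fin n → ℝ)),
        ρ = ((volume.restrict (Ioo a₁ b₁)).prod (volume.restrict (Ioo a₂ b₂))).prod
          ((P.map fun ω => tailTwo (M.X ω)).restrict B) →
        ρ ≪ P.map (fun ω => ((M.X ω 0, M.X ω 1), tailTwo (M.X ω))) →
        (¬ ∃ ψ : (Fin n → ℝ) → ℝ, Measurable ψ ∧
          ∀ᵐ p ∂ρ, φ (γ₁ * p.1.1 + γ₂ * p.1.2, p.2) = ψ p.2) →
        γ₂ ≠ 0 ∧ γ₁ / γ₂ = β₁ / β₂) := by 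
  obtain ⟨φ₀, hφ₀⟩ := M.exists_isSeparableCEF hJ exog hg hh
  refine ⟨⟨β₁, β₂, φ₀, hφ₀, hβ₂.ne', rfl⟩, ?_⟩
  intro γ₁ γ₂ φ hφ a₁ b₁ a₂ b₂ B _ ρ hρ hac hnd
  have hX := M.measurable_X
  have htail : Measurable (tailTwo (n := n)) := by unfold tailTwo; fun_prop
  have hmeas : MeasurableSet {p : (ℝ × ℝ) × (Fin n → ℝ) |
      φ (γ₁ * p.1.1 + γ₂ * p.1.2, p.2) = φ₀ (β₁ * p.1.1 + β₂ * p.1.2, p.2)} :=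
    measurableSet_eq_fun
      (hφ.1.comp (f := fun p : (ℝ × ℝ) × (Fin n → ℝ) => (γ₁ * p.1.1 + γ₂ * p.1.2, p.2))
        (by fun_prop))
      (hφ₀.1.comp (f := fun p : (ℝ × ℝ) × (Fin n → ℝ) => (β₁ * p.1.1 + β₂ * p.1.2, p.2))
        (by fun_prop))
  have hρeq : ∀ᵐ p ∂ρ, φ (γ₁ * p.1.1 + γ₂ * p.1.2, p.2) =
      φ₀ (β₁ * p.1.1 + β₂ * p.1.2, p.2) :=
    -- Both sides are versions of `E[R | X]`; the identity passes from `P` to the law of `X`, then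
    -- to `ρ` by absolute continuity.
    hac.ae_le ((ae_map_iff (by fun_prop) hmeas).2 (hφ.2.symm.trans hφ₀.2))
  have hdet : γ₁ * β₂ - γ₂ * β₁ = 0 := by
    by_contra hdet
    rw [hρ] at hρeq hnd
    exact hnd (exists_ae_eq_snd_of_linearForms hdet hφ.1 hφ₀.1 hρeq)
  -- If `γ₂ = 0`, proportionality and `β₂ ≠ 0` force `γ₁ = 0`, and the index vanishes: the
  -- degenerate case again.
  have hγ₂ : γ₂ ≠ 0 := by
    rintro rfl
    have hγ₁ : γ₁ = 0 := by simpa [hβ₂.ne'] using hdet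
    exact hnd ⟨fun z => φ (0, z), hφ.1.comp (by fun_prop), by simp [hγ₁]⟩
  exact ⟨hγ₂, by rw [div_eq_div_iff hγ₂ hβ₂.ne']; linarith⟩
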